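/- Fix an integer $d\ge 2$ and consider the family of maps $f_a(x)=-x+\sum_{j=2}^{d}a_jx^j$, $x\in\mathbb R$, with parameter $a=(a_2,\dots,a_d)\in\mathbb R^{d-1}$. Write $f_a(f_a(x))=x+\sum_{j\ge 3}W_j(a)x^j$ with $W_j\in\mathbb R[a_2,\dots,a_d]$. For $k\ge 3$ let the reduced stability constant $V_k\in\mathbb R[a_2,\dots,a_d]$ be the normal form (the remainder of division by a Gröbner basis) of $W_k$ modulo the ideal $\langle W_3,\dots,W_{k-1}\rangle$, with respect to the graded reverse lexicographic order with $a_2>a_3>\dots>a_d$. A 2-periodic orbit of $f$ is a set $\{x,y\}$ with $f(x)=y$, $f(y)=x$, $x\neq y$; it is isolated if it has a neighbourhood that contains no other 2-periodic orbit. Let $D_\rho(p)$ denote the open ball of radius $\rho$ centred at $p$. The origin of $f_{a^*}$ has cyclicity $N\in\mathbb N\cup\{0\}$ if (i) there are $\varepsilon_0,\delta_0>0$ such that the maximum, over $a\in D_{\varepsilon_0}(a^*)$, of the number of isolated 2-periodic orbits of $f_a$ contained in $D_{\delta_0}(0)$ is $N$; and (ii) for all $\varepsilon,\delta>0$ there is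 $a\in D_\varepsilon(a^*)$ such that $f_a$ has $N$ different isolated 2-periodic orbits contained in $D_\delta(0)$. Proposition. Let $m\ge 1$ and let $a^*\in\mathbb R^{d-1}$ be such that the origin is a weak fixed point of order $m-1$ of $f_{a^*}$, that is, $V_3(a^*)=V_5(a^*)=\dots=V_{2m-1}(a^*)=0$ and $V_{2m+1}(a^*)\neq 0$. Then $f_{a^*}$ has a cyclicity, and it is at most $m-1$. If, in addition, the $m-1$ gradients $\nabla V_3(a^*),\nabla V_5(a^*),\dots,\nabla V_{2m-1}(a^*)$ (with respect to $a_2,\dots,a_d$) are linearly independent, then the cyclicity of $f_{a^*}$ is exactly $m-1$. -/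

import Mathlib

namespace TwoCyclicity

/-! ### Two-periodic orbits and 2-cyclicity -/

/-- `O` is a 2-periodic orbit of `f`: a set `{x, y}` with `f x = y`, `f y = x` and `x ≠ y`. -/
def IsTwoPeriodicOrbit (f : ℝ → ℝ) (O : Set ℝ) : Prop :=
  ∃ x y : ℝ, O = {x, y} ∧ f x = y ∧ f y = x ∧ x ≠ y

/-- A 2-periodic orbit is isolated if it has a neighbourhood that contains no other one. -/
def IsIsolatedTwoPeriodicOrbit (f : ℝ → ℝ) (O : Set ℝ) : Prop :=
  IsTwoPeriodicOrbit f O ∧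
    ∃ U : Set ℝ, IsOpen U ∧ O ⊆ U ∧ ∀ O' : Set ℝ, IsTwoPeriodicOrbit f O' → O' ⊆ U → O' = O

/-- The set of the isolated 2-periodic orbits of `f` that lie within `D_δ(0)`. -/
def isolatedOrbitsWithin (f : ℝ → ℝ) (δ : ℝ) : Set (Set ℝ) :=
  {O | IsIsolatedTwoPeriodicOrbit f O ∧ O ⊆ Metric.ball (0 : ℝ) δ}

/-- In the family `f a`, with parameters `a` in `𝒱 ⊆ ℝⁿ`, the origin of the map `f a₀` has
2-cyclicity `N`:
(i) for some balls around `a₀` and `0`, the maximum over the parameter ball of the number of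
isolated 2-periodic orbits within the second ball is `N`;
(ii) arbitrarily close to `a₀` there are maps having `N` different isolated 2-periodic orbits
arbitrarily close to `0`. -/
def HasTwoCyclicity {n : ℕ} (𝒱 : Set (EuclideanSpace ℝ (Fin n)))
    (f : EuclideanSpace ℝ (Fin n) → ℝ → ℝ) (a₀ : EuclideanSpace ℝ (Fin n)) (N : ℕ) : Prop :=
  (∃ ε₀ > 0, ∃ δ₀ > 0, Metric.ball a₀ ε₀ ⊆ 𝒱 ∧
    IsGreatest ((fun a => (isolatedOrbitsWithin (f a) δ₀).encard) '' Metric.ball a₀ ε₀)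
      (N : ℕ∞)) ∧
  ∀ ε > 0, ∀ δ > 0, ∃ a ∈ Metric.ball a₀ ε ∩ 𝒱,
    (N : ℕ∞) ≤ (isolatedOrbitsWithin (f a) δ).encard

/-! ### The graded reverse lexicographic order -/

/-- Exponent vectors in the variables `x_0, …, x_{n-1}`, to be ordered by the graded reverse
lexicographic order with `x_0 > x_1 > ⋯ > x_{n-1}`. -/
def GrevLex (n : ℕ) : Type := Fin n →₀ ℕ

namespace GrevLex

variable {n : ℕ}

noncomputable instance : AddCommMonoid (GrevLex n) :=
  inferInstanceAs (AddCommMonoid (Fin n →₀ ℕ))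

/-- The underlying exponent vector. -/
def exps (α : GrevLex n) : Fin n →₀ ℕ := α

/-- Exponent vectors are compared by total degree, and ties are broken by the exponents of
`x_{n-1}, x_{n-2}, …, x_0`, in this order, where the smaller exponent gives the larger monomial. -/
noncomputable def key (α : GrevLex n) : ℕ ×ₗ Lex (Fin n → ℕᵒᵈ) :=
  toLex (α.exps.degree, toLex fun i => OrderDual.toDual (α.exps i.rev))

theorem key_injective : Function.Injective (key (n := n)) := by
  intro α β h
  have h2 : ∀ i : Fin n, α.exps i.rev = β.exps i.rev :=
    fun i => congrFun (congrArg (fun p => ofLex (ofLex p).2) h) i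
  refine Finsupp.ext (fun i => ?_)
  have h3 := h2 i.rev
  rw [Fin.rev_rev] at h3
  exact h3

theorem key_add (α β : GrevLex n) : key (α + β) = key α + key β := by
  refine congrArg toLex (Prod.ext ?_ ?_)
  · exact map_add Finsupp.degree α.exps β.exps
  · rfl

noncomputable instance : LinearOrder (GrevLex n) :=
  LinearOrder.lift' key key_injective

theorem lt_def {α β : GrevLex n} : α < β ↔ key α < key β := Iff.rfl

theorem le_def {α β : GrevLex n} : α ≤ β ↔ key α ≤ key β := Iff.rfl

instance : IsOrderedAddMonoid (GrevLex n) where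
  add_le_add_left α β h γ := by
    rw [le_def, Prod.Lex.le_iff] at h ⊢
    rw [key_add, key_add]
    rcases h with h | ⟨h1, h2⟩
    · exact Or.inl (add_lt_add_left h _)
    · exact Or.inr ⟨congrArg (· + _) h1, add_le_add_left h2 _⟩

theorem degree_le_of_le {α β : GrevLex n} (h : α ≤ β) :
    α.exps.degree ≤ β.exps.degree := by
  rw [le_def, Prod.Lex.le_iff] at h
  rcases h with h | h
  · exact h.le
  · exact h.1.le

instance : WellFoundedLT (GrevLex n) := by
  have hfin : ∀ β : GrevLex n, (Set.Iic β).Finite := fun β =>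
    (Finsupp.finite_of_degree_le (σ := Fin n) β.exps.degree).subset
      (fun _ h => degree_le_of_le h)
  refine ⟨Subrelation.wf (r := InvImage (· < ·) fun β : GrevLex n => (Set.Iic β).ncard) ?_
    (InvImage.wf _ wellFounded_lt)⟩
  intro α β h
  exact Set.ncard_lt_ncard (Set.Iic_ssubset_Iic.2 h) (hfin β)

end GrevLex

/-- The graded reverse lexicographic order with `x_0 > x_1 > ⋯ > x_{n-1}`. -/
noncomputable def grevlex (n : ℕ) : MonomialOrder (Fin n) where
  syn := GrevLex n
  toSyn := { toFun := fun α => α, invFun := GrevLex.exps, map_add' := fun _ _ => rfl }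
  toSyn_monotone := by
    intro α β h
    rcases h.eq_or_lt with h' | h'
    · exact h' ▸ le_rfl
    · refine le_of_lt (GrevLex.lt_def.2 (Prod.Lex.lt_iff.2 (Or.inl ?_)))
      obtain ⟨γ, rfl⟩ := exists_add_of_le h
      have hγ : γ ≠ 0 := by
        rintro rfl
        simp at h'
      change α.degree < (α + γ).degree
      rw [map_add]
      have := (Finsupp.degree_eq_zero_iff γ).not.2 hγ
      omega

/-- The usual description of the graded reverse lexicographic order. -/
theorem grevlex_lt_iff {n : ℕ} {α β : Fin n →₀ ℕ} :
    (grevlex n).toSyn α < (grevlex n).toSyn β ↔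
      α.degree < β.degree ∨
        (α.degree = β.degree ∧ ∃ i, β i < α i ∧ ∀ j, i < j → α j = β j) := by
  change GrevLex.key α < GrevLex.key β ↔ _
  rw [Prod.Lex.lt_iff]
  refine or_congr Iff.rfl (and_congr Iff.rfl ?_)
  constructor
  · rintro ⟨i, h1, h2⟩
    refine ⟨i.rev, h2, fun j hj => ?_⟩
    have h3 : α j.rev.rev = β j.rev.rev := h1 j.rev (Fin.rev_lt_iff.1 hj)
    rwa [Fin.rev_rev] at h3
  · rintro ⟨i, h1, h2⟩
    refine ⟨i.rev, fun j hj => ?_, ?_⟩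
    · exact h2 j.rev (Fin.lt_rev_iff.1 hj)
    · change α i.rev.rev > β i.rev.rev
      simpa using h1

/-! ### Normal forms modulo an ideal -/

/-- `r` is the normal form of `p` modulo the ideal `I`, that is, the remainder of the division of
`p` by a Gröbner basis of `I`: `r` is congruent to `p` modulo `I`, and no monomial of `r` is
divisible by the leading monomial of a nonzero element of `I`. -/
def IsNormalForm {σ : Type*} (ord : MonomialOrder σ) (I : Ideal (MvPolynomial σ ℝ))
    (p r : MvPolynomial σ ℝ) : Prop :=
  p - r ∈ I ∧ ∀ c ∈ r.support, ∀ g ∈ I, g ≠ 0 → ¬ ord.degree g ≤ c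

theorem existsUnique_isNormalForm {σ : Type*} (ord : MonomialOrder σ)
    (I : Ideal (MvPolynomial σ ℝ)) (p : MvPolynomial σ ℝ) : ∃! r, IsNormalForm ord I p r := by
  obtain ⟨g, r, h1, -, h3⟩ := ord.div_set (B := {b | b ∈ I ∧ b ≠ 0})
    (fun b hb => (ord.leadingCoeff_ne_zero_iff.2 hb.2).isUnit) p
  refine ⟨r, ⟨?_, fun c hc b hb hb0 => h3 c hc b ⟨hb, hb0⟩⟩, ?_⟩
  · rw [h1, add_sub_cancel_right, Finsupp.linearCombination_apply]
    exact I.sum_mem fun b _ => I.mul_mem_left _ b.2.1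
  · rintro s ⟨hs, hs'⟩
    have hr : p - r ∈ I := by
      rw [h1, add_sub_cancel_right, Finsupp.linearCombination_apply]
      exact I.sum_mem fun b _ => I.mul_mem_left _ b.2.1
    by_contra hne
    have hsub : s - r ∈ I := by
      have := I.sub_mem hr hs
      rwa [sub_sub_sub_cancel_left] at this
    have h0 : s - r ≠ 0 := sub_ne_zero.2 hne
    have hmem : ord.degree (s - r) ∈ (s - r).support := ord.degree_mem_support h0
    classical
    rcases Finset.mem_union.1 (MvPolynomial.support_sub _ s r hmem) with h | h
    · exact hs' _ h _ hsub h0 le_rfl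
    · exact h3 _ h _ ⟨hsub, h0⟩ le_rfl

/-- The normal form of `p` modulo the ideal `I`, with respect to the monomial order `ord`. -/
noncomputable def normalForm {σ : Type*} (ord : MonomialOrder σ) (I : Ideal (MvPolynomial σ ℝ))
    (p : MvPolynomial σ ℝ) : MvPolynomial σ ℝ :=
  (existsUnique_isNormalForm ord I p).choose

theorem normalForm_spec {σ : Type*} (ord : MonomialOrder σ) (I : Ideal (MvPolynomial σ ℝ))
    (p : MvPolynomial σ ℝ) : IsNormalForm ord I p (normalForm ord I p) :=
  (existsUnique_isNormalForm ord I p).choose_spec.1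

/-! ### The polynomial family and its stability constants

The parameters are `a = (a_2, …, a_d) ∈ ℝ^{d-1}`; the coordinate with index `i : Fin (d - 1)` is
`a_{i+2}`. -/

/-- The family `f_a(x) = -x + ∑_{j=2}^d a_j x^j`. -/
noncomputable def polyFamily (d : ℕ) (a : EuclideanSpace ℝ (Fin (d - 1))) (x : ℝ) : ℝ :=
  -x + ∑ i : Fin (d - 1), a i * x ^ ((i : ℕ) + 2)

/-- The map `-x + ∑_{j=2}^d a_j x^j` as a polynomial in `x` over `ℝ[a_2, …, a_d]`. -/
noncomputable def genericMap (d : ℕ) : Polynomial (MvPolynomial (Fin (d - 1)) ℝ) :=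
  -Polynomial.X +
    ∑ i : Fin (d - 1), Polynomial.C (MvPolynomial.X i) * Polynomial.X ^ ((i : ℕ) + 2)

/-- The stability constant `W_k ∈ ℝ[a_2, …, a_d]`: the coefficient of `x^k` in `f_a (f_a x)`. -/
noncomputable def W (d k : ℕ) : MvPolynomial (Fin (d - 1)) ℝ :=
  ((genericMap d).comp (genericMap d)).coeff k

/-- The reduced stability constant `V_k`: the normal form of `W_k` modulo the ideal
`⟨W_3, …, W_{k-1}⟩` with respect to the graded reverse lexicographic order with
`a_2 > a_3 > ⋯ > a_d`. -/
noncomputable def V (d k : ℕ) : MvPolynomial (Fin (d - 1)) ℝ :=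
  normalForm (grevlex (d - 1)) (Ideal.span {p | ∃ j, 3 ≤ j ∧ j < k ∧ p = W d j}) (W d k)

/-- The reduced stability constant `V_k` as a function on the parameter space. -/
noncomputable def VFun (d k : ℕ) (a : EuclideanSpace ℝ (Fin (d - 1))) : ℝ :=
  MvPolynomial.eval (fun i => a i) (V d k)

end TwoCyclicity

/-!
Close to the origin, `f_a` exchanges the two sides of `0`, so 2-periodic orbits correspond to the
positive zeros of the displacement `f_a (f_a x) - x = ∑ W_k(a) x ^ k`.

The constants `W_k` of even index lie in the ideal of the preceding ones, because the two ways of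
composing three copies of `f_a` agree (`W_mem_span_W_of_even`). Hence `W_k` lies in the ideal
generated by the reduced constants `V_3, V_5, …` of odd index at most `k`, and where `V_{2m+1}` is
invertible this yields `f_a (f_a x) - x = ∑ V_{2j+3}(a) x ^ (2j+3) u_j(a, x)`, a sum over `j < m`
with `u_j` analytic and `u_j(a₀, 0) = 1` (`exists_displacement_eq_sum`).

Upper bound: such a sum has at most `m - 1` zeros in a fixed interval `(0, δ)`, by repeatedly
dividing by the leading term and applying Rolle's theorem (`exists_encard_zeros_sum_lt`). In
particular orbits near the origin are finite in number, hence isolated, and a cyclicity exists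
because the counts are locally bounded (`exists_hasTwoCyclicity_of_forall_le`).

Lower bound: when the gradients are independent, `a ↦ (V_3(a), …, V_{2m-1}(a))` maps neighbourhoods
of `a₀` onto neighbourhoods of `0` (`map_nhds_eq_of_linearIndependent_gradient`). The constants can
therefore be chosen so that the displacement, rescaled by `x = r y`, approaches a multiple of
`y ^ 3 ∏ (y ^ 2 - i ^ 2)` as `r → 0`, whose `m - 1` sign changes persist
(`exists_le_encard_zeros`).
-/

/-! ### Stability constants of even index -/

namespace TwoCyclicity
open Polynomial

/-- The first nonlinear term of `f ∘ f` has odd degree, for `f = -X + ⋯`: if it were `w Xⁿ` with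
`n` even, then `f ∘ (f ∘ f)` would have the term `-w Xⁿ` on top of `f`, since `f` has multiplier
`-1`, while `(f ∘ f) ∘ f` would have `(-1)ⁿ w Xⁿ = w Xⁿ`. -/
theorem two_mul_coeff_comp_self_eq_zero {S : Type*} [CommRing S] {f g : S[X]}
    (hf : f = -X + X ^ 2 * g) {n : ℕ} (hn : Even n) (hn2 : 2 ≤ n)
    (hF : ∀ j, 2 ≤ j → j < n → (f.comp f).coeff j = 0) :
    2 * (f.comp f).coeff n = 0 := by
  have hXf : X ∣ f := ⟨-1 + X * g, by rw [hf]; ring⟩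
  have hFX : X ^ 2 ∣ f.comp f - X := by
    obtain ⟨q, hq⟩ := hXf
    refine ⟨-g + q ^ 2 * g.comp f, ?_⟩
    have h1 : f.comp f = -f + f ^ 2 * g.comp f := by
      conv_lhs => rw [hf]
      simp only [add_comp, neg_comp, X_comp, mul_comp, pow_comp]
      rw [← hf]
    rw [h1]
    linear_combination (-1 : S[X]) * hf + (g.comp f) * (f + X * q) * hq
  obtain ⟨h, hh⟩ : X ^ n ∣ f.comp f - X := by
    rw [X_pow_dvd_iff]
    intro j hj
    rcases lt_or_ge j 2 with h | h
    · exact X_pow_dvd_iff.1 hFX j h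
    · rw [coeff_sub, hF j h hj, coeff_X_of_ne_one (by omega), sub_zero]
  set F := f.comp f with hFdef
  have hcoeff : F.coeff n = h.coeff 0 := by
    have h1 : F = X + X ^ n * h := by rw [← hh]; ring
    rw [h1, coeff_add, coeff_X_of_ne_one (by omega), zero_add]
    simpa using coeff_X_pow_mul h n 0
  -- the two ways of composing three copies of `f`
  have hassoc : f.comp F = F.comp f := by rw [hFdef, comp_assoc]
  have hleft : X ^ (n + 1) ∣ f.comp F - (f - X ^ n * h) := by
    have h1 : f.comp F = -F + F ^ 2 * g.comp F := by
      conv_lhs => rw [hf]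
      simp only [add_comp, neg_comp, X_comp, mul_comp, pow_comp]
    obtain ⟨k, hk⟩ : F - X ∣ g.comp F - g := by
      have := sub_dvd_eval_sub F X (g.map C)
      simpa [← eval₂_eq_eval_map, comp, eval₂_C_X] using this
    obtain ⟨l, hl⟩ : X ∣ F := by
      have h2 := (dvd_pow_self X two_ne_zero).trans hFX
      exact (dvd_sub_left (dvd_refl X)).1 h2
    refine ⟨h * ((l + 1) * g.comp F + X * k), ?_⟩
    have hh' : F - X = X ^ n * h := hh
    rw [h1]
    calc -F + F ^ 2 * g.comp F - (f - X ^ n * h)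
        = (F - X) * (F + X) * g.comp F + X ^ 2 * (g.comp F - g) := by
          rw [← hh', hf]; ring
      _ = X ^ (n + 1) * (h * ((l + 1) * g.comp F + X * k)) := by
          rw [hk, hh']; rw [pow_succ]; linear_combination (X ^ n * h * g.comp F) * hl
  have hright : F.comp f = f + X ^ n * ((-1 + X * g) ^ n * h.comp f) := by
    have h1 : F = X + X ^ n * h := by rw [← hh]; ring
    have h2 : f = X * (-1 + X * g) := by rw [hf]; ring
    rw [h1]
    simp only [add_comp, X_comp, mul_comp, pow_comp]
    rw [← mul_assoc, ← mul_pow, ← h2]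
  have h3 := X_pow_dvd_iff.1 hleft n (Nat.lt_succ_self n)
  have hf0 : f.coeff 0 = 0 := X_dvd_iff.1 hXf
  rw [hassoc, hright] at h3
  have e1 : (X ^ n * h).coeff n = h.coeff 0 := by simpa using coeff_X_pow_mul h n 0
  have e2 : (X ^ n * ((-1 + X * g) ^ n * h.comp f)).coeff n = h.coeff 0 := by
    have := coeff_X_pow_mul ((-1 + X * g) ^ n * h.comp f) n 0
    rw [zero_add] at this
    rw [this, mul_coeff_zero, coeff_zero_eq_eval_zero, coeff_zero_eq_eval_zero (h.comp f),
      eval_comp, ← coeff_zero_eq_eval_zero f, hf0, ← coeff_zero_eq_eval_zero h]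
    simp [hn.neg_one_pow]
  rw [coeff_sub, coeff_add, coeff_sub, e1, e2] at h3
  rw [hcoeff]
  linear_combination h3

theorem genericMap_eq (d : ℕ) : ∃ g, genericMap d = -X + X ^ 2 * g := by
  refine ⟨∑ i : Fin (d - 1), C (MvPolynomial.X i) * X ^ (i : ℕ), ?_⟩
  rw [Finset.mul_sum]
  unfold genericMap
  refine congrArg (-X + ·) (Finset.sum_congr rfl fun i _ => ?_)
  rw [pow_add, mul_comm (X ^ 2), mul_assoc]

/-- A stability constant of even index is redundant: it lies in the ideal of the preceding ones. -/
theorem W_mem_span_W_of_even (d : ℕ) {n : ℕ} (hn : Even n) (hn2 : 2 ≤ n) :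
    W d n ∈ Ideal.span {p | ∃ j, 3 ≤ j ∧ j < n ∧ p = W d j} := by
  obtain ⟨g, hg⟩ := genericMap_eq d
  -- working modulo `I`, the preceding coefficients vanish, and `2` is invertible
  have key : ∀ (I : Ideal (MvPolynomial (Fin (d - 1)) ℝ)) (n : ℕ), Even n → 2 ≤ n →
      (∀ j, 2 ≤ j → j < n → W d j ∈ I) → W d n ∈ I := by
    intro I n hn hn2 hI
    have hcomp : ∀ k, (((genericMap d).map (Ideal.Quotient.mk I)).comp
        ((genericMap d).map (Ideal.Quotient.mk I))).coeff k = Ideal.Quotient.mk I (W d k) := by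
      intro k
      rw [← Polynomial.map_comp, coeff_map, W]
    have h := two_mul_coeff_comp_self_eq_zero (f := (genericMap d).map (Ideal.Quotient.mk I))
      (g := g.map (Ideal.Quotient.mk I)) (by rw [hg]; simp) hn hn2 (by
        intro j h2 hj
        rw [hcomp]
        exact Ideal.Quotient.eq_zero_iff_mem.2 (hI j h2 hj))
    rw [hcomp, ← map_ofNat (Ideal.Quotient.mk I) 2, ← map_mul, Ideal.Quotient.eq_zero_iff_mem] at h
    have h2 := I.mul_mem_left (MvPolynomial.C (1 / 2 : ℝ)) h
    have e : MvPolynomial.C (1 / 2 : ℝ) * (2 * W d n) = W d n := by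
      rw [← mul_assoc, ← map_ofNat (MvPolynomial.C : ℝ →+* _) 2, ← map_mul]
      norm_num
    rwa [e] at h2
  refine key _ n hn hn2 fun j hj2 hjn => ?_
  rcases hj2.eq_or_lt with rfl | hj3
  · have := key ⊥ 2 even_two le_rfl (fun j h1 h2 => by omega)
    rw [Ideal.mem_bot] at this
    rw [this]
    exact Ideal.zero_mem _
  · exact Ideal.subset_span ⟨j, hj3, hjn, rfl⟩

theorem W_sub_V_mem (d k : ℕ) :
    W d k - V d k ∈ Ideal.span {p | ∃ j, 3 ≤ j ∧ j < k ∧ p = W d j} :=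
  (normalForm_spec _ _ _).1

/-- The ideal of the stability constants of index below `k` is generated by the reduced ones of odd
index. -/
theorem span_W_le_span_V (d k : ℕ) :
    Ideal.span {p | ∃ j, 3 ≤ j ∧ j < k ∧ p = W d j} ≤
      Ideal.span ((fun i => V d (2 * i + 3)) '' {i | 2 * i + 3 < k}) := by
  induction k with
  | zero =>
    rw [Ideal.span_le]
    rintro p ⟨j, -, hj, -⟩
    omega
  | succ k ih =>
    have hmono : Ideal.span ((fun i => V d (2 * i + 3)) '' {i | 2 * i + 3 < k}) ≤
        Ideal.span ((fun i => V d (2 * i + 3)) '' {i | 2 * i + 3 < k + 1}) :=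
      Ideal.span_mono (Set.image_mono fun i hi => Nat.lt_succ_of_lt hi)
    rw [Ideal.span_le]
    rintro p ⟨j, hj3, hjk, rfl⟩
    rcases (Nat.lt_succ_iff.1 hjk).lt_or_eq with hj | rfl
    · exact hmono (ih (Ideal.subset_span ⟨j, hj3, hj, rfl⟩))
    · rcases Nat.even_or_odd j with he | ⟨t, ht⟩
      · exact hmono (ih (W_mem_span_W_of_even d he (by omega)))
      · have h1 := hmono (ih (W_sub_V_mem d j))
        have h2 : V d j ∈ Ideal.span ((fun i => V d (2 * i + 3)) '' {i | 2 * i + 3 < j + 1}) := by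
          refine Ideal.subset_span ⟨t - 1, ?_, ?_⟩
          · simp only [Set.mem_ofPred_eq]; omega
          · simp only; congr 1; omega
        have := Ideal.add_mem _ h1 h2
        rwa [sub_add_cancel] at this

theorem W_zero (d : ℕ) : W d 0 = 0 := by
  obtain ⟨g, hg⟩ := genericMap_eq d
  have h0 : (genericMap d).eval 0 = 0 := by rw [hg]; simp
  rw [W, coeff_zero_eq_eval_zero, eval_comp, h0, h0]

theorem W_one (d : ℕ) : W d 1 = 1 := by
  obtain ⟨g, hg⟩ := genericMap_eq d
  have h0 : (genericMap d).eval 0 = 0 := by rw [hg]; simp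
  have h1 : (derivative (genericMap d)).eval 0 = -1 := by rw [hg]; simp
  have : W d 1 = (derivative ((genericMap d).comp (genericMap d))).eval 0 := by
    rw [← coeff_zero_eq_eval_zero, coeff_derivative]
    simp [W]
  rw [this, derivative_comp]
  simp [eval_comp, h0, h1]

theorem W_two (d : ℕ) : W d 2 = 0 := by
  have h := W_mem_span_W_of_even d even_two le_rfl
  have e : {p | ∃ j, 3 ≤ j ∧ j < 2 ∧ p = W d j} = ∅ := by
    ext p
    simp only [Set.mem_ofPred_eq, Set.mem_empty_iff_false, iff_false]
    rintro ⟨j, h1, h2, -⟩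
    omega
  rwa [e, Ideal.span_empty, Ideal.mem_bot] at h

end TwoCyclicity

/-! ### Counting zeros by division and derivation -/

namespace TwoCyclicity
open Set

/-- Rolle's theorem, as a bound on the number of zeros. -/
theorem encard_zeros_le_encard_zeros_deriv_add_one {h h' : ℝ → ℝ} {c δ : ℝ}
    (hd : ∀ x ∈ Ioo c δ, HasDerivAt h (h' x) x) :
    {x ∈ Ioo c δ | h x = 0}.encard ≤ {x ∈ Ioo c δ | h' x = 0}.encard + 1 := by
  by_contra! hlt
  have hfin : {x ∈ Ioo c δ | h' x = 0}.Finite := by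
    rw [← encard_lt_top_iff]
    exact lt_of_le_of_lt le_self_add (lt_of_lt_of_le hlt le_top)
  obtain ⟨B, hB⟩ := hfin.exists_finset_coe
  rw [← hB, encard_coe_eq_coe_finsetCard] at hlt
  have h2 : ((B.card + 2 : ℕ) : ℕ∞) ≤ {x ∈ Ioo c δ | h x = 0}.encard := by
    have := Order.add_one_le_of_lt hlt
    rwa [add_assoc, one_add_one_eq_two] at this
  obtain ⟨t, ht, htc⟩ := exists_subset_encard_eq h2
  have htf : t.Finite := finite_of_encard_eq_coe htc
  obtain ⟨s, rfl⟩ := htf.exists_finset_coe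
  rw [encard_coe_eq_coe_finsetCard, Nat.cast_inj] at htc
  let e := s.orderEmbOfFin htc
  have he : ∀ i, e i ∈ Ioo c δ ∧ h (e i) = 0 := fun i => ht (s.orderEmbOfFin_mem htc i)
  have hsub : ∀ i j : Fin (B.card + 2), Icc (e i) (e j) ⊆ Ioo c δ := fun i j x hx =>
    ⟨(he i).1.1.trans_le hx.1, hx.2.trans_lt (he j).1.2⟩
  have hξ : ∀ i : Fin (B.card + 1), ∃ ξ ∈ Ioo (e i.castSucc) (e i.succ), h' ξ = 0 := fun i =>
    exists_hasDerivAt_eq_zero (e.strictMono Fin.castSucc_lt_succ)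
      (fun x hx => (hd x (hsub _ _ hx)).continuousAt.continuousWithinAt)
      ((he _).2.trans (he _).2.symm) fun x hx => hd x (hsub _ _ (Ioo_subset_Icc_self hx))
  choose ξ hξI hξ0 using hξ
  have hmono : StrictMono ξ := by
    refine Fin.strictMono_iff_lt_succ.2 fun i => (hξI i.castSucc).2.trans ?_
    exact (hξI i.succ).1
  have hmaps : ∀ i ∈ (Finset.univ : Finset (Fin (B.card + 1))), ξ i ∈ B := fun i _ => by
    have : ξ i ∈ (B : Set ℝ) := hB ▸ ⟨hsub _ _ (Ioo_subset_Icc_self (hξI i)), hξ0 i⟩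
    exact this
  have := Finset.card_le_card_of_injOn ξ hmaps hmono.injective.injOn
  simp at this

variable {E : Type*} [NormedAddCommGroup E] [NormedSpace ℝ E]

/-- Division–derivation: a nontrivial combination of `m` perturbed powers `x ^ n j * u j (a, x)`,
where `u j` is an analytic unit at `(a₀, 0)`, has fewer than `m` zeros in some interval `(0, δ)`,
with `δ` uniform in the coefficients `v` and in the parameter `a` near `a₀`. Dividing by the term
of lowest order and differentiating in `x` gives a combination of `m - 1` such functions, and loses
at most one zero. -/
theorem exists_encard_zeros_sum_lt (a₀ : E) (m : ℕ) : ∀ (n : Fin m → ℕ), StrictMono n →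
    ∀ u : Fin m → E × ℝ → ℝ, (∀ j, AnalyticAt ℝ (u j) (a₀, 0)) → (∀ j, u j (a₀, 0) ≠ 0) →
    ∃ δ > 0, ∀ a ∈ Metric.ball a₀ δ, ∀ v : Fin m → ℝ, v ≠ 0 →
      {x ∈ Ioo 0 δ | ∑ j, v j * (x ^ n j * u j (a, x)) = 0}.encard + 1 ≤ m := by
  induction m with
  | zero =>
    intro n _ u _ _
    exact ⟨1, one_pos, fun a _ v hv => absurd (Subsingleton.elim v 0) hv⟩
  | succ m ih =>
    intro n hn u hu hu0
    set w : Fin m → E × ℝ → ℝ := fun j p => u j.succ p / u 0 p with hw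
    set N : Fin m → ℕ := fun j => n j.succ - n 0 with hNdef
    have hN : ∀ j : Fin m, n 0 < n j.succ := fun j => hn (Fin.succ_pos j)
    have hwA : ∀ j, AnalyticAt ℝ (w j) (a₀, 0) := fun j => (hu _).div (hu 0) (hu0 0)
    -- the derivative of `x ^ N j * w j (a, x)` in `x` is `x ^ (N j - 1) * u' j (a, x)`
    set u' : Fin m → E × ℝ → ℝ :=
      fun j p => (N j : ℝ) * w j p + p.2 * fderiv ℝ (w j) p (0, 1) with hu'
    obtain ⟨δ₁, hδ₁, H⟩ := ih (fun j => N j - 1)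
      (fun i j hij => by
        have h1 := hn (Fin.succ_lt_succ_iff.2 hij)
        have h2 := hN i
        have h3 := hN j
        simp only [hNdef]
        omega) u'
      (fun j => by
        refine (analyticAt_const.mul (hwA j)).add (analyticAt_snd.mul ?_)
        exact ((ContinuousLinearMap.apply ℝ ℝ ((0, 1) : E × ℝ)).analyticAt _).comp
          (hwA j).fderiv)
      (fun j => by
        have : (N j : ℝ) ≠ 0 := by
          have := hN j
          simp only [hNdef]
          exact_mod_cast (Nat.sub_pos_of_lt this).ne'
        simpa [hu', hw, hu0] using this)
    have hev : ∀ᶠ p in nhds (a₀, (0 : ℝ)), u 0 p ≠ 0 ∧ ∀ j, AnalyticAt ℝ (w j) p :=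
      ((hu 0).continuousAt.eventually_ne (hu0 0)).and
        (Filter.eventually_all.2 fun j => (hwA j).eventually_analyticAt)
    obtain ⟨δ₂, hδ₂, hball⟩ := Metric.eventually_nhds_iff.1 hev
    refine ⟨min δ₁ δ₂, lt_min hδ₁ hδ₂, fun a ha v hv => ?_⟩
    have ha1 : a ∈ Metric.ball a₀ δ₁ := Metric.ball_subset_ball (min_le_left _ _) ha
    have hloc : ∀ x ∈ Ioo 0 (min δ₁ δ₂), u 0 (a, x) ≠ 0 ∧ ∀ j, AnalyticAt ℝ (w j) (a, x) := by
      intro x hx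
      refine hball ?_
      rw [Prod.dist_eq]
      refine max_lt (lt_of_lt_of_le ha (min_le_right _ _)) ?_
      rw [Real.dist_eq, sub_zero, abs_of_pos hx.1]
      exact lt_of_lt_of_le hx.2 (min_le_right _ _)
    -- without the other coefficients, the first term alone has no positive zero
    by_cases hvt : (fun j : Fin m => v j.succ) = 0
    · have hv0 : v 0 ≠ 0 := by
        intro h0
        refine hv (funext fun j => ?_)
        refine Fin.cases h0 (fun i => congrFun hvt i) j
      have hempty : {x ∈ Ioo 0 (min δ₁ δ₂) | ∑ j, v j * (x ^ n j * u j (a, x)) = 0} = ∅ := by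
        refine eq_empty_of_forall_notMem fun x hx => ?_
        have h2 := hx.2
        rw [Fin.sum_univ_succ, Finset.sum_eq_zero fun i _ => by
          rw [show v i.succ = 0 from congrFun hvt i, zero_mul], add_zero] at h2
        exact mul_ne_zero hv0 (mul_ne_zero (pow_pos hx.1.1 _).ne' (hloc x hx.1).1) h2
      rw [hempty]
      simp
    · set h : ℝ → ℝ := fun x => v 0 + ∑ j : Fin m, v j.succ * (x ^ N j * w j (a, x)) with hh
      have hderiv : ∀ x ∈ Ioo 0 (min δ₁ δ₂), HasDerivAt h
          (∑ j : Fin m, v j.succ * (x ^ (N j - 1) * u' j (a, x))) x := by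
        intro x hx
        have h1 : ∀ j : Fin m, HasDerivAt (fun x => v j.succ * (x ^ N j * w j (a, x)))
            (v j.succ * (x ^ (N j - 1) * u' j (a, x))) x := by
          intro j
          have h2 : HasDerivAt (fun x => w j (a, x)) (fderiv ℝ (w j) (a, x) (0, 1)) x :=
            ((hloc x hx).2 j).differentiableAt.hasFDerivAt.comp_hasDerivAt x
              ((hasDerivAt_const x a).prodMk (hasDerivAt_id x))
          refine (((hasDerivAt_pow (N j) x).fun_mul h2).const_mul (v j.succ)).congr_deriv ?_
          have h4 : x ^ N j = x ^ (N j - 1) * x := by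
            rw [← pow_succ, Nat.sub_add_cancel (Nat.sub_pos_of_lt (hN j))]
          rw [h4]
          simp only [hu']
          ring
        exact (HasDerivAt.fun_sum fun j _ => h1 j).const_add (v 0)
      have hzeros : {x ∈ Ioo 0 (min δ₁ δ₂) | ∑ j, v j * (x ^ n j * u j (a, x)) = 0} ⊆
          {x ∈ Ioo 0 (min δ₁ δ₂) | h x = 0} := by
        rintro x ⟨hx, h0⟩
        refine ⟨hx, ?_⟩
        have hfac : ∑ j, v j * (x ^ n j * u j (a, x)) = x ^ n 0 * u 0 (a, x) * h x := by
          rw [Fin.sum_univ_succ, hh, mul_add, Finset.mul_sum]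
          congr 1
          · ring
          · refine Finset.sum_congr rfl fun j _ => ?_
            have h4 : x ^ n j.succ = x ^ n 0 * x ^ N j := by
              rw [← pow_add, Nat.add_sub_cancel' (hN j).le]
            simp only [hw]
            rw [h4]
            field_simp [(hloc x hx).1]
        rw [hfac] at h0
        exact (mul_eq_zero.1 h0).resolve_left
          (mul_ne_zero (pow_pos hx.1 _).ne' (hloc x hx).1)
      have hB : {x ∈ Ioo 0 (min δ₁ δ₂) |
          ∑ j : Fin m, v j.succ * (x ^ (N j - 1) * u' j (a, x)) = 0}.encard + 1 ≤ m :=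
        le_trans (by
          gcongr
          exact min_le_left _ _) (H a ha1 _ hvt)
      calc _ ≤ {x ∈ Ioo 0 (min δ₁ δ₂) | h x = 0}.encard + 1 := by gcongr
        _ ≤ _ + 1 + 1 := by
          gcongr
          exact encard_zeros_le_encard_zeros_deriv_add_one hderiv
        _ ≤ (m : ℕ∞) + 1 := by gcongr
        _ = ((m + 1 : ℕ) : ℕ∞) := by push_cast; rfl
end TwoCyclicity

/-! ### The displacement as a combination of perturbed powers -/

namespace TwoCyclicity
open Set

theorem polyFamily_eq_eval_map (d : ℕ) (a : EuclideanSpace ℝ (Fin (d - 1))) (x : ℝ) :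
    polyFamily d a x = ((genericMap d).map (MvPolynomial.eval fun i => a i)).eval x := by
  simp only [polyFamily, genericMap, Polynomial.map_add, Polynomial.map_neg, Polynomial.map_X,
    Polynomial.map_sum, Polynomial.map_mul, Polynomial.map_C, Polynomial.map_pow,
    MvPolynomial.eval_X, Polynomial.eval_add, Polynomial.eval_neg, Polynomial.eval_X,
    Polynomial.eval_finsetSum, Polynomial.eval_mul, Polynomial.eval_C, Polynomial.eval_pow]

theorem polyFamily_comp_self_eq_sum (d : ℕ) (a : EuclideanSpace ℝ (Fin (d - 1))) (x : ℝ) {n : ℕ}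
    (hn : ((genericMap d).comp (genericMap d)).natDegree < n) :
    polyFamily d a (polyFamily d a x) =
      ∑ k ∈ Finset.range n, MvPolynomial.eval (fun i => a i) (W d k) * x ^ k := by
  rw [polyFamily_eq_eval_map, polyFamily_eq_eval_map, ← Polynomial.eval_comp,
    ← Polynomial.map_comp,
    Polynomial.eval_eq_sum_range' (lt_of_le_of_lt Polynomial.natDegree_map_le hn)]
  simp only [Polynomial.coeff_map, W]

theorem analyticAt_eval (n : ℕ) (p : MvPolynomial (Fin n) ℝ) (a₀ : EuclideanSpace ℝ (Fin n)) :
    AnalyticAt ℝ (fun a : EuclideanSpace ℝ (Fin n) => MvPolynomial.eval (fun i => a i) p) a₀ :=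
  AnalyticAt.aeval_mvPolynomial (A := ℝ) (f := fun (a : EuclideanSpace ℝ (Fin n)) i => a i)
    (fun i => (EuclideanSpace.proj i : EuclideanSpace ℝ (Fin n) →L[ℝ] ℝ).analyticAt a₀) p

theorem exists_eq_sum_of_mem_span (d : ℕ) {m k : ℕ} (hk : k ≤ 2 * m + 1)
    {p : MvPolynomial (Fin (d - 1)) ℝ}
    (hp : p ∈ Ideal.span ((fun i => V d (2 * i + 3)) '' {i | 2 * i + 3 < k})) :
    ∃ c : Fin m → MvPolynomial (Fin (d - 1)) ℝ, (∀ j : Fin m, k ≤ 2 * (j : ℕ) + 3 → c j = 0) ∧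
      p = ∑ j : Fin m, c j * V d (2 * (j : ℕ) + 3) := by
  obtain ⟨l, hl, rfl⟩ := (Finsupp.mem_span_image_iff_linearCombination _).1 hp
  have hsupp : ∀ i, k ≤ 2 * i + 3 → l i = 0 := fun i hi => by
    by_contra h
    have : i ∈ {i | 2 * i + 3 < k} := hl (Finsupp.mem_support_iff.2 h)
    rw [mem_ofPred_eq] at this
    omega
  refine ⟨fun j => l j, fun j hj => hsupp j hj, ?_⟩
  rw [Finsupp.linearCombination_apply, Finsupp.sum_of_support_subset (s := Finset.range m),
    Finset.sum_range]
  · rfl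
  · intro i hi
    by_contra h
    rw [Finset.mem_range] at h
    exact Finsupp.mem_support_iff.1 hi (hsupp i (by omega))
  · simp

/-- Up to the index `2 * m + 1`, the constant `W_k` is a combination of `V_3, V_5, …` with
polynomial coefficients; no constant of index above `k` occurs, and `V_k` has coefficient `1`. -/
theorem exists_W_eq_sum (d : ℕ) {m k : ℕ} (hk3 : 3 ≤ k) (hk : k ≤ 2 * m + 1) :
    ∃ c : Fin m → MvPolynomial (Fin (d - 1)) ℝ, (∀ j : Fin m, k < 2 * (j : ℕ) + 3 → c j = 0) ∧
      (∀ j : Fin m, k = 2 * (j : ℕ) + 3 → c j = 1) ∧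
      W d k = ∑ j : Fin m, c j * V d (2 * (j : ℕ) + 3) := by
  rcases Nat.even_or_odd k with he | ⟨t, ht⟩
  · obtain ⟨c, hc, hW⟩ := exists_eq_sum_of_mem_span d hk
      (span_W_le_span_V d k (W_mem_span_W_of_even d he (by omega)))
    obtain ⟨r, hr⟩ := he
    exact ⟨c, fun j hj => hc j hj.le, fun j hj => by omega, hW⟩
  · obtain ⟨c, hc, hW⟩ := exists_eq_sum_of_mem_span d hk (span_W_le_span_V d k (W_sub_V_mem d k))
    obtain ⟨s, rfl⟩ : ∃ s, k = 2 * s + 3 := ⟨t - 1, by omega⟩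
    have hs : s < m := by omega
    refine ⟨c + Pi.single ⟨s, hs⟩ 1, fun j hj => ?_, fun j hj => ?_, ?_⟩
    · have : j ≠ ⟨s, hs⟩ := by rintro rfl; simp at hj
      simp [hc j hj.le, this]
    · obtain rfl : j = ⟨s, hs⟩ := Fin.ext (by simp only; omega)
      simp [hc _ hj.le]
    · simp only [Pi.add_apply, add_mul, Finset.sum_add_distrib, ← hW, Pi.single_apply, ite_mul,
        one_mul, zero_mul, Finset.sum_ite_eq', Finset.mem_univ, if_true]
      ring

/-- Near a parameter where `V_{2m+1}` does not vanish, every `W_k` is a combination of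
`V_3, V_5, …, V_{2m+1}` with analytic coefficients. -/
theorem exists_eval_W_eq_sum (d : ℕ) {m : ℕ} (hm : 1 ≤ m) (a₀ : EuclideanSpace ℝ (Fin (d - 1)))
    (hne : VFun d (2 * m + 1) a₀ ≠ 0) {k : ℕ} (hk3 : 3 ≤ k) :
    ∃ c : Fin m → EuclideanSpace ℝ (Fin (d - 1)) → ℝ, (∀ j, AnalyticAt ℝ (c j) a₀) ∧
      (∀ (j : Fin m) a, k < 2 * (j : ℕ) + 3 → c j a = 0) ∧
      (∀ (j : Fin m) a, k = 2 * (j : ℕ) + 3 → c j a = 1) ∧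
      ∀ a, VFun d (2 * m + 1) a ≠ 0 → MvPolynomial.eval (fun i => a i) (W d k) =
        ∑ j : Fin m, c j a * VFun d (2 * (j : ℕ) + 3) a := by
  rcases le_or_gt k (2 * m + 1) with hk | hk
  · obtain ⟨c, h0, h1, hW⟩ := exists_W_eq_sum d hk3 hk
    refine ⟨fun j a => MvPolynomial.eval (fun i => a i) (c j), fun j => analyticAt_eval _ _ _,
      fun j a hj => by simp [h0 j hj], fun j a hj => by simp [h1 j hj], fun a _ => ?_⟩
    simp [hW, VFun]
  · -- beyond the order of the fixed point, divide by the invertible constant `V_{2m+1}`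
    have hlast : m - 1 < m := by omega
    have hidx : 2 * (m - 1) + 3 = 2 * m + 1 := by omega
    refine ⟨fun j a => if j = ⟨m - 1, hlast⟩ then
      MvPolynomial.eval (fun i => a i) (W d k) / VFun d (2 * m + 1) a else 0, fun j => ?_,
      fun j a hj => by omega, fun j a hj => by omega, fun a ha => ?_⟩
    · by_cases hj : j = ⟨m - 1, hlast⟩
      · simp only [hj, if_true]
        exact (analyticAt_eval _ _ _).div (analyticAt_eval _ _ _) hne
      · simp only [hj, if_false]
        exact analyticAt_const
    · simp only [ite_mul, zero_mul, Finset.sum_ite_eq', Finset.mem_univ, if_true, hidx]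
      rw [div_mul_cancel₀ _ ha]

/-- The displacement `f_a (f_a x) - x` is the combination of the perturbed powers
`x ^ 3, x ^ 5, …, x ^ (2m+1)` with the coefficients `V_3 a, V_5 a, …, V_{2m+1} a`. -/
theorem exists_displacement_eq_sum (d : ℕ) {m : ℕ} (hm : 1 ≤ m)
    (a₀ : EuclideanSpace ℝ (Fin (d - 1))) (hne : VFun d (2 * m + 1) a₀ ≠ 0) :
    ∃ u : Fin m → EuclideanSpace ℝ (Fin (d - 1)) × ℝ → ℝ,
      (∀ j, AnalyticAt ℝ (u j) (a₀, 0)) ∧ (∀ j, u j (a₀, 0) = 1) ∧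
      ∀ a, VFun d (2 * m + 1) a ≠ 0 → ∀ x, polyFamily d a (polyFamily d a x) - x =
        ∑ j : Fin m, VFun d (2 * (j : ℕ) + 3) a * (x ^ (2 * (j : ℕ) + 3) * u j (a, x)) := by
  choose c hcA hc0 hc1 hcW using fun k : ℕ => exists_eval_W_eq_sum d hm a₀ hne
    (k := k + 3) (Nat.le_add_left 3 k)
  obtain ⟨n, hn1, hn2⟩ : ∃ n, ((genericMap d).comp (genericMap d)).natDegree < n + 3 ∧
      2 * m < n := ⟨((genericMap d).comp (genericMap d)).natDegree + 2 * m + 1, by omega, by omega⟩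
  refine ⟨fun j p => ∑ k ∈ Finset.range n, c k j p.1 * p.2 ^ (k - 2 * (j : ℕ)), fun j => ?_,
    fun j => ?_, fun a ha x => ?_⟩
  · refine Finset.analyticAt_fun_sum _ fun k _ => ?_
    exact ((hcA k j).comp_of_eq analyticAt_fst rfl).mul (analyticAt_snd.pow _)
  · beta_reduce
    rw [Finset.sum_eq_single (2 * (j : ℕ))]
    · simp [hc1 (2 * (j : ℕ)) j a₀ rfl]
    · intro k _ hk
      rcases lt_or_gt_of_ne hk with h | h
      · simp only [hc0 k j a₀ (by omega), zero_mul]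
      · simp only [zero_pow (Nat.sub_ne_zero_of_lt h), mul_zero]
    · intro h
      have := j.2
      rw [Finset.mem_range] at h
      omega
  -- the terms of degree at most `2` add up to `x`
  · rw [polyFamily_comp_self_eq_sum d a x hn1, Finset.sum_range_succ', Finset.sum_range_succ',
      Finset.sum_range_succ', W_zero, W_one, W_two]
    have h1 : ∀ k ∈ Finset.range n,
        MvPolynomial.eval (fun i => a i) (W d (k + 1 + 1 + 1)) * x ^ (k + 1 + 1 + 1) =
        ∑ j : Fin m, VFun d (2 * (j : ℕ) + 3) a *
          (x ^ (2 * (j : ℕ) + 3) * (c k j a * x ^ (k - 2 * (j : ℕ)))) := by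
      intro k _
      rw [hcW k a ha, Finset.sum_mul]
      refine Finset.sum_congr rfl fun j _ => ?_
      rcases lt_or_ge k (2 * (j : ℕ)) with h | h
      · simp [hc0 k j a (by omega)]
      · have h2 : x ^ (k + 1 + 1 + 1) = x ^ (2 * (j : ℕ) + 3) * x ^ (k - 2 * (j : ℕ)) := by
          rw [← pow_add]
          congr 1
          omega
        rw [h2]
        ring
    rw [Finset.sum_congr rfl h1, Finset.sum_comm]
    simp only [map_zero, map_one, zero_mul, Finset.mul_sum]
    ring
end TwoCyclicity

/-! ### Two-periodic orbits, zeros of the displacement, and cyclicity -/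

namespace TwoCyclicity
open Set

theorem IsTwoPeriodicOrbit.eq_pair {f : ℝ → ℝ} {O : Set ℝ} (hO : IsTwoPeriodicOrbit f O) {z : ℝ}
    (hz : z ∈ O) : O = {z, f z} := by
  obtain ⟨x, y, rfl, hxy, hyx, -⟩ := hO
  rcases hz with rfl | hz
  · rw [hxy]
  · rw [mem_singleton_iff] at hz
    rw [hz, hyx, pair_comm]

/-- If a ball contains only finitely many 2-periodic orbits, then all of them are isolated. -/
theorem isolatedOrbitsWithin_eq_of_finite {f : ℝ → ℝ} {δ : ℝ}
    (hfin : {O | IsTwoPeriodicOrbit f O ∧ O ⊆ Metric.ball (0 : ℝ) δ}.Finite) :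
    isolatedOrbitsWithin f δ = {O | IsTwoPeriodicOrbit f O ∧ O ⊆ Metric.ball (0 : ℝ) δ} := by
  refine Subset.antisymm (fun O hO => ⟨hO.1.1, hO.2⟩) fun O hO => ⟨⟨hO.1, ?_⟩, hO.2⟩
  -- remove the finitely many other orbits from the ball
  set P := {O | IsTwoPeriodicOrbit f O ∧ O ⊆ Metric.ball (0 : ℝ) δ}
  refine ⟨Metric.ball 0 δ \ ⋃ O' ∈ P \ {O}, O', ?_, ?_, ?_⟩
  · refine Metric.isOpen_ball.sdiff ((hfin.subset sdiff_subset).isClosed_biUnion fun O' hO' => ?_)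
    obtain ⟨x, y, rfl, -⟩ := hO'.1.1
    exact (toFinite _).isClosed
  · refine fun z hz => ⟨hO.2 hz, fun hz' => ?_⟩
    obtain ⟨O', hO', hzO'⟩ := mem_iUnion₂.1 hz'
    exact hO'.2 ((hO'.1.1.eq_pair hzO').trans (hO.1.eq_pair hz).symm)
  · intro O' hO' hsub
    by_contra hne
    obtain ⟨z, hz⟩ : O'.Nonempty := by
      obtain ⟨x, y, rfl, -⟩ := hO'
      exact ⟨x, mem_insert _ _⟩
    exact (hsub hz).2 (mem_iUnion₂.2 ⟨O', ⟨⟨hO', fun w hw => (hsub hw).1⟩, hne⟩, hz⟩)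

/-- If `f` exchanges the two sides of the origin, then each 2-periodic orbit has a positive
point, which is a zero of the displacement `f (f x) - x`. -/
theorem twoPeriodicOrbits_subset_image {f : ℝ → ℝ} {δ : ℝ} (h0 : f 0 = 0)
    (hneg : ∀ x ∈ Metric.ball (0 : ℝ) δ, x ≠ 0 → f x * x < 0) :
    {O | IsTwoPeriodicOrbit f O ∧ O ⊆ Metric.ball (0 : ℝ) δ} ⊆
      (fun x => {x, f x}) '' {x ∈ Ioo 0 δ | f (f x) - x = 0} := by
  rintro O ⟨hO, hsub⟩
  suffices h : ∃ z ∈ O, 0 < z by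
    obtain ⟨z, hz, hz0⟩ := h
    refine ⟨z, ⟨⟨hz0, ?_⟩, ?_⟩, (hO.eq_pair hz).symm⟩
    · have := hsub hz
      rw [mem_ball_zero_iff, Real.norm_eq_abs] at this
      exact (le_abs_self z).trans_lt this
    · obtain ⟨x, y, rfl, hxy, hyx, -⟩ := hO
      rcases hz with rfl | hz
      · rw [hxy, hyx, sub_self]
      · rw [mem_singleton_iff] at hz
        rw [hz, hyx, hxy, sub_self]
  obtain ⟨x, y, rfl, hxy, hyx, hne⟩ := hO
  have hx0 : x ≠ 0 := by
    rintro rfl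
    exact hne (h0.symm.trans hxy)
  have hx := hneg x (hsub (mem_insert _ _)) hx0
  rw [hxy] at hx
  rcases lt_or_gt_of_ne hx0 with h | h
  · exact ⟨y, by simp, pos_of_mul_neg_left hx h.le⟩
  · exact ⟨x, by simp, h⟩

theorem image_subset_twoPeriodicOrbits {f : ℝ → ℝ} {δ η : ℝ} (hδη : η ≤ δ)
    (hneg : ∀ x ∈ Metric.ball (0 : ℝ) η, x ≠ 0 → f x * x < 0)
    (hbd : ∀ x ∈ Ioo 0 η, f x ∈ Metric.ball (0 : ℝ) δ) :
    (fun x => {x, f x}) '' {x ∈ Ioo 0 η | f (f x) - x = 0} ⊆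
      {O | IsTwoPeriodicOrbit f O ∧ O ⊆ Metric.ball (0 : ℝ) δ} := by
  rintro _ ⟨x, ⟨hx, hfx⟩, rfl⟩
  have hxη : x ∈ Metric.ball (0 : ℝ) η := by
    rw [mem_ball_zero_iff, Real.norm_eq_abs, abs_of_pos hx.1]
    exact hx.2
  have h1 := hneg x hxη hx.1.ne'
  refine ⟨⟨x, f x, rfl, rfl, sub_eq_zero.1 hfx, fun h => ?_⟩, ?_⟩
  · rw [← h] at h1
    exact absurd h1 (not_lt.2 (mul_self_nonneg x))
  · rintro z (rfl | rfl)
    · exact Metric.ball_subset_ball hδη hxη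
    · exact hbd x hx

/-- Different positive points lie in different orbits: the other point of an orbit is negative. -/
theorem injOn_pair {f : ℝ → ℝ} {η : ℝ}
    (hneg : ∀ x ∈ Metric.ball (0 : ℝ) η, x ≠ 0 → f x * x < 0) :
    InjOn (fun x => ({x, f x} : Set ℝ)) (Ioo 0 η) := by
  intro x hx y hy hxy
  have hxy' : ({x, f x} : Set ℝ) = {y, f y} := hxy
  have hyη : y ∈ Metric.ball (0 : ℝ) η := by
    rw [mem_ball_zero_iff, Real.norm_eq_abs, abs_of_pos hy.1]
    exact hy.2
  have h1 : x ∈ ({y, f y} : Set ℝ) := hxy' ▸ mem_insert _ _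
  rcases h1 with h1 | h1
  · exact h1
  · rw [mem_singleton_iff] at h1
    have h2 := neg_of_mul_neg_left (hneg y hyη hy.1.ne') hy.1.le
    rw [← h1] at h2
    exact absurd hx.1 h2.le.not_gt

/-- Near the origin, every map close to `f_{a₀}` exchanges the two sides of `0`, and at most
doubles distances to `0`. -/
theorem exists_polyFamily_neg (d : ℕ) (a₀ : EuclideanSpace ℝ (Fin (d - 1))) :
    ∃ ρ > 0, ∀ a ∈ Metric.ball a₀ ρ, ∀ x ∈ Metric.ball (0 : ℝ) ρ, x ≠ 0 →
      polyFamily d a x * x < 0 ∧ |polyFamily d a x| < 2 * |x| := by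
  set g : EuclideanSpace ℝ (Fin (d - 1)) × ℝ → ℝ :=
    fun p => 1 - ∑ i : Fin (d - 1), p.1 i * p.2 ^ ((i : ℕ) + 1) with hg
  have hgc : ContinuousAt g (a₀, 0) := by
    apply Continuous.continuousAt
    fun_prop
  have hg0 : g (a₀, 0) = 1 := by simp [hg]
  have hev : ∀ᶠ p in nhds (a₀, (0 : ℝ)), g p ∈ Ioo (0 : ℝ) 2 :=
    hgc.eventually (by rw [hg0]; exact Ioo_mem_nhds one_pos one_lt_two)
  obtain ⟨ρ, hρ, H⟩ := Metric.eventually_nhds_iff.1 hev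
  refine ⟨ρ, hρ, fun a ha x hx hx0 => ?_⟩
  have hgx : g (a, x) ∈ Ioo (0 : ℝ) 2 := H (by
    rw [Prod.dist_eq]
    exact max_lt ha hx)
  have hf : polyFamily d a x = -x * g (a, x) := by
    simp only [polyFamily, hg]
    rw [mul_sub, mul_one, neg_mul, sub_neg_eq_add, Finset.mul_sum]
    refine congrArg (-x + ·) (Finset.sum_congr rfl fun i _ => ?_)
    ring
  rw [hf]
  refine ⟨?_, ?_⟩
  · have : 0 < x ^ 2 * g (a, x) := mul_pos (by positivity) hgx.1
    linarith
  · rw [abs_mul, abs_neg, abs_of_pos hgx.1, mul_comm]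
    exact mul_lt_mul_of_pos_right hgx.2 (abs_pos.2 hx0)

theorem polyFamily_zero (d : ℕ) (a : EuclideanSpace ℝ (Fin (d - 1))) : polyFamily d a 0 = 0 := by
  simp [polyFamily]

theorem isolatedOrbitsWithin_mono (f : ℝ → ℝ) {δ δ' : ℝ} (h : δ ≤ δ') :
    isolatedOrbitsWithin f δ ⊆ isolatedOrbitsWithin f δ' :=
  fun _ hO => ⟨hO.1, hO.2.trans (Metric.ball_subset_ball h)⟩

section Cyclicity

variable {n : ℕ} {f : EuclideanSpace ℝ (Fin n) → ℝ → ℝ} {a₀ : EuclideanSpace ℝ (Fin n)}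

theorem hasTwoCyclicity_of_le_of_forall_exists {N : ℕ}
    (hle : ∃ ε > 0, ∃ δ > 0, ∀ a ∈ Metric.ball a₀ ε,
      (isolatedOrbitsWithin (f a) δ).encard ≤ (N : ℕ∞))
    (hex : ∀ ε > 0, ∀ δ > 0, ∃ a ∈ Metric.ball a₀ ε,
      (N : ℕ∞) ≤ (isolatedOrbitsWithin (f a) δ).encard) :
    HasTwoCyclicity univ f a₀ N := by
  obtain ⟨ε, hε, δ, hδ, hle⟩ := hle
  refine ⟨⟨ε, hε, δ, hδ, subset_univ _, ?_, ?_⟩, fun ε' hε' δ' hδ' => ?_⟩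
  · obtain ⟨a, ha, hNa⟩ := hex ε hε δ hδ
    exact ⟨a, ha, le_antisymm (hle a ha) hNa⟩
  · rintro _ ⟨a, ha, rfl⟩
    exact hle a ha
  · obtain ⟨a, ha, hNa⟩ := hex ε' hε' δ' hδ'
    exact ⟨a, ⟨ha, mem_univ _⟩, hNa⟩

theorem HasTwoCyclicity.le_of_forall_le {N M : ℕ} (hN : HasTwoCyclicity univ f a₀ N)
    (hle : ∃ ε > 0, ∃ δ > 0, ∀ a ∈ Metric.ball a₀ ε,
      (isolatedOrbitsWithin (f a) δ).encard ≤ (M : ℕ∞)) : N ≤ M := by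
  obtain ⟨ε, hε, δ, hδ, hle⟩ := hle
  obtain ⟨a, ha, hNa⟩ := hN.2 ε hε δ hδ
  exact Nat.cast_le.1 (hNa.trans (hle a ha.1))

theorem HasTwoCyclicity.unique {N M : ℕ} (hN : HasTwoCyclicity univ f a₀ N)
    (hM : HasTwoCyclicity univ f a₀ M) : N = M := by
  have key : ∀ {N M : ℕ}, HasTwoCyclicity univ f a₀ N → HasTwoCyclicity univ f a₀ M → N ≤ M := by
    intro N M hN hM
    obtain ⟨ε, hε, δ, hδ, -, hmax⟩ := hM.1
    exact hN.le_of_forall_le ⟨ε, hε, δ, hδ, fun a ha => hmax.2 ⟨a, ha, rfl⟩⟩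
  exact le_antisymm (key hN hM) (key hM hN)

/-- A local bound on the number of orbits suffices for a cyclicity to exist: the least such bound is
one, since by minimality it is attained in arbitrarily small neighbourhoods. -/
theorem exists_hasTwoCyclicity_of_forall_le {M : ℕ}
    (hle : ∃ ε > 0, ∃ δ > 0, ∀ a ∈ Metric.ball a₀ ε,
      (isolatedOrbitsWithin (f a) δ).encard ≤ (M : ℕ∞)) :
    ∃ N : ℕ, HasTwoCyclicity univ f a₀ N := by
  classical
  have hP : ∃ k : ℕ, ∃ ε > 0, ∃ δ > 0, ∀ a ∈ Metric.ball a₀ ε,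
      (isolatedOrbitsWithin (f a) δ).encard ≤ (k : ℕ∞) := ⟨M, hle⟩
  refine ⟨Nat.find hP, hasTwoCyclicity_of_le_of_forall_exists (Nat.find_spec hP) ?_⟩
  intro ε hε δ hδ
  rcases hk : Nat.find hP with _ | k
  · exact ⟨a₀, Metric.mem_ball_self hε, by simp⟩
  · have hmin := Nat.find_min hP (m := k) (by omega)
    by_contra! hcon
    refine hmin ⟨ε, hε, δ, hδ, fun a ha => ?_⟩
    have h1 := hcon a ha
    push_cast at h1
    exact Order.le_of_lt_add_one h1

end Cyclicity

/-- At a weak fixed point of order `m - 1`, nearby maps have at most `m - 1` 2-periodic orbits near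
the origin. -/
theorem exists_forall_encard_isolatedOrbitsWithin_le (d : ℕ) {m : ℕ} (hm : 1 ≤ m)
    (a₀ : EuclideanSpace ℝ (Fin (d - 1))) (hne : VFun d (2 * m + 1) a₀ ≠ 0) :
    ∃ ρ > 0, ∀ a ∈ Metric.ball a₀ ρ,
      {O | IsTwoPeriodicOrbit (polyFamily d a) O ∧ O ⊆ Metric.ball (0 : ℝ) ρ}.encard + 1 ≤ m := by
  obtain ⟨u, huA, hu1, hdisp⟩ := exists_displacement_eq_sum d hm a₀ hne
  obtain ⟨δ, hδ, H⟩ := exists_encard_zeros_sum_lt a₀ m (fun j => 2 * (j : ℕ) + 3)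
    (fun i j hij => by
      have : (i : ℕ) < j := hij
      simp only
      omega) u huA (fun j => by simp [hu1])
  obtain ⟨r, hr, hneg⟩ := exists_polyFamily_neg d a₀
  obtain ⟨ε, hε, hball⟩ := Metric.eventually_nhds_iff.1
    ((analyticAt_eval _ (V d (2 * m + 1)) a₀).continuousAt.eventually_ne hne)
  refine ⟨min δ (min r ε), lt_min hδ (lt_min hr hε), fun a ha => ?_⟩
  have haδ : a ∈ Metric.ball a₀ δ := Metric.ball_subset_ball (min_le_left _ _) ha
  have har : a ∈ Metric.ball a₀ r :=
    Metric.ball_subset_ball ((min_le_right _ _).trans (min_le_left _ _)) ha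
  have haV : VFun d (2 * m + 1) a ≠ 0 :=
    hball (Metric.ball_subset_ball ((min_le_right _ _).trans (min_le_right _ _)) ha)
  have hv : (fun j : Fin m => VFun d (2 * (j : ℕ) + 3) a) ≠ 0 := by
    intro h
    have h1 := congrFun h ⟨m - 1, by omega⟩
    have h2 : 2 * (m - 1) + 3 = 2 * m + 1 := by omega
    simp only [h2] at h1
    exact haV h1
  refine le_trans ?_ (H a haδ _ hv)
  gcongr
  refine (encard_le_encard (twoPeriodicOrbits_subset_image (polyFamily_zero d a) fun x hx hx0 =>
    (hneg a har x (Metric.ball_subset_ball ((min_le_right _ _).trans (min_le_left _ _)) hx)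
      hx0).1)).trans ((encard_image_le _ _).trans (encard_le_encard ?_))
  rintro x ⟨hx, hx0⟩
  exact ⟨⟨hx.1, hx.2.trans_le (min_le_left _ _)⟩, (hdisp a haV x).symm.trans hx0⟩
end TwoCyclicity

/-! ### Creating orbits by perturbation -/

namespace TwoCyclicity
open Set Filter Topology

theorem exists_zero_of_mul_neg {g : ℝ → ℝ} (hg : Continuous g) {a b : ℝ} (hab : a ≤ b)
    (h : g a * g b < 0) : ∃ c ∈ Ioo a b, g c = 0 := by
  rcases mul_neg_iff.1 h with ⟨h1, h2⟩ | ⟨h1, h2⟩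
  · obtain ⟨c, hc, h0⟩ := intermediate_value_Ioo' hab hg.continuousOn ⟨h2, h1⟩
    exact ⟨c, hc, h0⟩
  · obtain ⟨c, hc, h0⟩ := intermediate_value_Ioo hab hg.continuousOn ⟨h1, h2⟩
    exact ⟨c, hc, h0⟩

/-- The polynomial `∏ (t - (i + 1)²)` with `N` simple positive roots. -/
noncomputable def squaresPoly (N : ℕ) : Polynomial ℝ :=
  ∏ i ∈ Finset.range N, (Polynomial.X - Polynomial.C (((i : ℝ) + 1) ^ 2))

theorem squaresPoly_monic (N : ℕ) : (squaresPoly N).Monic :=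
  Polynomial.monic_prod_X_sub_C _ _

theorem squaresPoly_natDegree (N : ℕ) : (squaresPoly N).natDegree = N := by
  rw [squaresPoly, Polynomial.natDegree_prod_of_monic _ _ fun _ _ => Polynomial.monic_X_sub_C _]
  simp only [Polynomial.natDegree_X_sub_C, Finset.sum_const, Finset.card_range,
    smul_eq_mul, mul_one]

theorem squaresPoly_eval_mul_neg {N i : ℕ} (hi : i < N) :
    (squaresPoly N).eval (((i : ℝ) + 1 / 2) ^ 2) *
      (squaresPoly N).eval ((((i + 1 : ℕ) : ℝ) + 1 / 2) ^ 2) < 0 := by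
  have hfac : ∀ k : ℕ, (((i : ℝ) + 1 / 2) ^ 2 - ((k : ℝ) + 1) ^ 2) *
      ((((i + 1 : ℕ) : ℝ) + 1 / 2) ^ 2 - ((k : ℝ) + 1) ^ 2) =
      ((i : ℝ) - k - 1 / 2) * ((i : ℝ) - k + 1 / 2) *
        (((i : ℝ) + k + 3 / 2) * ((i : ℝ) + k + 5 / 2)) := by
    intro k
    push_cast
    ring
  simp only [squaresPoly, Polynomial.eval_prod, Polynomial.eval_sub, Polynomial.eval_X,
    Polynomial.eval_C]
  rw [← Finset.prod_mul_distrib, ← Finset.mul_prod_erase _ _ (Finset.mem_range.2 hi)]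
  refine mul_neg_of_neg_of_pos ?_ (Finset.prod_pos fun k hk => ?_)
  · rw [hfac]
    refine mul_neg_of_neg_of_pos ?_ (by positivity)
    norm_num
  · rw [hfac]
    refine mul_pos ?_ (by positivity)
    rcases lt_or_gt_of_ne (Finset.ne_of_mem_erase hk) with h | h
    · have : (k : ℝ) + 1 ≤ i := by exact_mod_cast h
      exact mul_pos (by linarith) (by linarith)
    · have : (i : ℝ) + 1 ≤ k := by exact_mod_cast h
      exact mul_pos_of_neg_of_neg (by linarith) (by linarith)

/-- If the coefficients of the lower powers take all small values near `a₀`, then small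
perturbations create `N` zeros of `∑ v j a * (x ^ (2 * j + 3) * u j (a, x))` close to `0`. The
coefficients are chosen so that, at the scale `x = r * y` and after division by `r ^ (2 * N + 3)`,
the sum tends as `r → 0` to a multiple of `y ^ 3 * ∏ (y ^ 2 - (i + 1) ^ 2)`. -/
theorem exists_le_encard_zeros {E : Type*} [TopologicalSpace E] {a₀ : E} {N : ℕ}
    {G : E → ℝ → ℝ} (hGc : ∀ a, Continuous (G a)) {v : Fin (N + 1) → E → ℝ}
    {u : Fin (N + 1) → E × ℝ → ℝ} (hu : ∀ j, ContinuousAt (u j) (a₀, 0))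
    (hu1 : ∀ j, u j (a₀, 0) = 1) (hvc : ContinuousAt (v (Fin.last N)) a₀)
    (hv0 : v (Fin.last N) a₀ ≠ 0)
    (hG : ∀ᶠ a in 𝓝 a₀, ∀ x, G a x = ∑ j, v j a * (x ^ (2 * (j : ℕ) + 3) * u j (a, x)))
    (hopen : 𝓝 0 ≤ map (fun a (j : Fin N) => v j.castSucc a) (𝓝 a₀))
    {A : Set E} (hA : A ∈ 𝓝 a₀) {δ : ℝ} (hδ : 0 < δ) :
    ∃ a ∈ A, (N : ℕ∞) ≤ {x ∈ Ioo 0 δ | G a x = 0}.encard := by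
  set c := v (Fin.last N) a₀ with hc
  set Q := squaresPoly N with hQ
  -- the values required of the first `N` coefficients at the scale `r`
  set T : ℝ → Fin N → ℝ := fun r j => c * Q.coeff j * r ^ (2 * (N - j)) with hT
  have hT0 : Tendsto T (𝓝[>] 0) (𝓝 0) := by
    have h1 : Continuous T := by fun_prop
    have h2 : T 0 = 0 := by
      funext j
      have : 2 * (N - (j : ℕ)) ≠ 0 := by have := j.2; omega
      simp [hT, zero_pow this]
    rw [← h2]
    exact h1.continuousAt.tendsto.mono_left nhdsWithin_le_nhds
  -- along `l`, the parameter `a` tends to `a₀` and `r` to `0⁺`, while `a` realizes `T r`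
  set l : Filter (E × ℝ) := (𝓝 a₀ ×ˢ 𝓝[>] 0) ⊓ 𝓟 {p | ∀ j : Fin N, v j.castSucc p.1 = T p.2 j}
    with hl
  have hne : l.NeBot := by
    rw [hl, inf_principal_neBot_iff]
    intro U hU
    obtain ⟨U₁, hU₁, U₂, hU₂, hsub⟩ := mem_prod_iff.1 hU
    have h1 : (fun a (j : Fin N) => v j.castSucc a) '' U₁ ∈ 𝓝 (0 : Fin N → ℝ) :=
      hopen (image_mem_map hU₁)
    obtain ⟨r, hr, a, ha, har⟩ := Filter.nonempty_of_mem (inter_mem hU₂ (hT0 h1))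
    exact ⟨(a, r), hsub ⟨ha, hr⟩, fun j => congrFun har j⟩
  have hl1 : Tendsto Prod.fst l (𝓝 a₀) := tendsto_fst.mono_left inf_le_left
  have hl2 : Tendsto Prod.snd l (𝓝[>] 0) := tendsto_snd.mono_left inf_le_left
  have hl2' : Tendsto Prod.snd l (𝓝 (0 : ℝ)) := hl2.mono_right nhdsWithin_le_nhds
  -- the rescaled displacement converges to `c y³ Q(y²)`
  have hlim : ∀ y : ℝ, Tendsto (fun p : E × ℝ => G p.1 (p.2 * y) / p.2 ^ (2 * N + 3)) l
      (𝓝 (c * y ^ 3 * Q.eval (y ^ 2))) := by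
    intro y
    have huy : ∀ j, Tendsto (fun p : E × ℝ => u j (p.1, p.2 * y)) l (𝓝 1) := by
      intro j
      rw [← hu1 j]
      refine (hu j).tendsto.comp (hl1.prodMk_nhds ?_)
      simpa using hl2'.mul_const y
    have hsum : Tendsto (fun p : E × ℝ =>
        ∑ j : Fin N, c * Q.coeff j * (y ^ (2 * (j : ℕ) + 3) * u j.castSucc (p.1, p.2 * y)) +
          v (Fin.last N) p.1 * (y ^ (2 * N + 3) * u (Fin.last N) (p.1, p.2 * y))) l
        (𝓝 (∑ j : Fin N, c * Q.coeff j * (y ^ (2 * (j : ℕ) + 3) * 1) +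
          c * (y ^ (2 * N + 3) * 1))) :=
      (tendsto_finsetSum _ fun j _ => ((huy _).const_mul _).const_mul _).add
        ((hvc.tendsto.comp hl1).mul ((huy _).const_mul _))
    have hval : ∑ j : Fin N, c * Q.coeff j * (y ^ (2 * (j : ℕ) + 3) * 1) +
        c * (y ^ (2 * N + 3) * 1) = c * y ^ 3 * Q.eval (y ^ 2) := by
      have hlead : Q.coeff N = 1 := by
        have := (squaresPoly_monic N).coeff_natDegree
        rwa [squaresPoly_natDegree] at this
      rw [Polynomial.eval_eq_sum_range, squaresPoly_natDegree, Finset.sum_range_succ, hlead,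
        Finset.sum_range, mul_add, Finset.mul_sum]
      congr 1
      · refine Finset.sum_congr rfl fun j _ => ?_
        ring
      · ring
    rw [← hval]
    refine hsum.congr' ?_
    have hr : ∀ᶠ p : E × ℝ in l, 0 < p.2 := hl2.eventually self_mem_nhdsWithin
    have hv : ∀ᶠ p : E × ℝ in l, ∀ j : Fin N, v j.castSucc p.1 = T p.2 j :=
      mem_inf_of_right (mem_principal_self _)
    filter_upwards [hr, hv, hl1.eventually hG] with p hp hvp hGp
    rw [hGp, eq_div_iff (pow_pos hp _).ne', Fin.sum_univ_castSucc, add_mul, Finset.sum_mul]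
    congr 1
    · refine Finset.sum_congr rfl fun j _ => ?_
      have h1 : p.2 ^ (2 * N + 3) = p.2 ^ (2 * (N - (j : ℕ))) * p.2 ^ (2 * (j : ℕ) + 3) := by
        rw [← pow_add]
        congr 1
        have := j.2
        omega
      rw [hvp j, hT, h1, Fin.val_castSucc, mul_pow]
      ring
    · rw [Fin.val_last, mul_pow]
      ring
  -- the limit changes sign between the half-integers `i + 1/2` and `i + 3/2`
  have hsign : ∀ᶠ p : E × ℝ in l, ∀ i : Fin N,
      G p.1 (p.2 * ((i : ℝ) + 1 / 2)) * G p.1 (p.2 * (((i + 1 : ℕ) : ℝ) + 1 / 2)) < 0 := by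
    refine eventually_all.2 fun i => ?_
    have h1 := (hlim ((i : ℝ) + 1 / 2)).mul (hlim (((i + 1 : ℕ) : ℝ) + 1 / 2))
    have h2 : c * ((i : ℝ) + 1 / 2) ^ 3 * Q.eval (((i : ℝ) + 1 / 2) ^ 2) *
        (c * (((i + 1 : ℕ) : ℝ) + 1 / 2) ^ 3 * Q.eval ((((i + 1 : ℕ) : ℝ) + 1 / 2) ^ 2)) < 0 := by
      have h3 := squaresPoly_eval_mul_neg i.2
      have h4 : 0 < c ^ 2 * ((i : ℝ) + 1 / 2) ^ 3 * (((i + 1 : ℕ) : ℝ) + 1 / 2) ^ 3 := by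
        positivity
      have h5 := mul_neg_of_pos_of_neg h4 h3
      rw [hQ]
      linarith
    filter_upwards [h1.eventually_lt_const h2, hl2.eventually self_mem_nhdsWithin] with p hp hr
    have hr' : 0 < p.2 ^ (2 * N + 3) := pow_pos hr _
    rw [div_mul_div_comm] at hp
    by_contra! hcon
    exact absurd hp (not_lt.2 (div_nonneg hcon (mul_pos hr' hr').le))
  have hsmall : ∀ᶠ p : E × ℝ in l, p.2 * ((N : ℝ) + 1) < δ := by
    have h1 : Tendsto (fun p : E × ℝ => p.2 * ((N : ℝ) + 1)) l (𝓝 (0 * ((N : ℝ) + 1))) :=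
      hl2'.mul_const _
    rw [zero_mul] at h1
    exact h1.eventually_lt_const hδ
  obtain ⟨⟨a, r⟩, hs, hrδ, hr, ha⟩ := (hsign.and (hsmall.and
    ((hl2.eventually self_mem_nhdsWithin).and (hl1.eventually hA)))).exists
  simp only at hs hrδ ha
  have hr : 0 < r := hr
  refine ⟨a, ha, ?_⟩
  choose ξ hξ hξ0 using fun i : Fin N => exists_zero_of_mul_neg (hGc a)
    (mul_le_mul_of_nonneg_left (by push_cast; linarith) hr.le) (hs i)
  have hmono : StrictMono ξ := by
    intro i j hij
    refine (hξ i).2.trans_le (le_trans ?_ (hξ j).1.le)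
    refine mul_le_mul_of_nonneg_left ?_ hr.le
    have : ((i + 1 : ℕ) : ℝ) ≤ (j : ℕ) := by
      have : (i : ℕ) + 1 ≤ j := hij
      exact_mod_cast this
    linarith
  have hrange : range ξ ⊆ {x ∈ Ioo 0 δ | G a x = 0} := by
    rintro _ ⟨i, rfl⟩
    refine ⟨⟨lt_trans (by positivity) (hξ i).1, (hξ i).2.trans (lt_of_le_of_lt ?_ hrδ)⟩, hξ0 i⟩
    refine mul_le_mul_of_nonneg_left ?_ hr.le
    have : ((i + 1 : ℕ) : ℝ) ≤ N := by exact_mod_cast i.2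
    linarith
  refine le_trans ?_ (encard_le_encard hrange)
  rw [← image_univ, hmono.injective.encard_image]
  simp

theorem map_nhds_eq_of_linearIndependent_gradient {F : Type*} [NormedAddCommGroup F]
    [InnerProductSpace ℝ F] [CompleteSpace F] {N : ℕ} {g : Fin N → F → ℝ} {a₀ : F}
    (hg : ∀ j, AnalyticAt ℝ (g j) a₀)
    (hli : LinearIndependent ℝ fun j => gradient (g j) a₀) :
    map (fun a j => g j a) (𝓝 a₀) = 𝓝 fun j => g j a₀ := by
  have hd : HasStrictFDerivAt (fun a j => g j a)
      (ContinuousLinearMap.pi fun j => fderiv ℝ (g j) a₀) a₀ :=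
    hasStrictFDerivAt_pi.2 fun j => (hg j).hasStrictFDerivAt
  refine hd.map_nhds_eq_of_surj ?_
  -- a functional vanishing on the range is a linear relation between the gradients
  rw [LinearMap.range_eq_top, ← LinearMap.dualMap_injective_iff, injective_iff_map_eq_zero]
  intro φ hφ
  have hφsum : ∀ w : Fin N → ℝ, φ w = ∑ j, w j * φ (Pi.single j 1) := by
    intro w
    conv_lhs => rw [pi_eq_sum_univ' w, map_sum]
    simp
  have hsum : ∑ j, φ (Pi.single j 1) • gradient (g j) a₀ = 0 := by
    refine ext_inner_right ℝ fun x => ?_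
    have h1 : φ (fun j => fderiv ℝ (g j) a₀ x) = 0 := LinearMap.congr_fun hφ x
    rw [hφsum] at h1
    rw [sum_inner, inner_zero_left, ← h1]
    refine Finset.sum_congr rfl fun j _ => ?_
    rw [inner_smul_left, ← InnerProductSpace.toDual_apply_apply, toDual_gradient]
    simp [mul_comm]
  have hzero := Fintype.linearIndependent_iff.1 hli _ hsum
  ext j
  simpa using hzero j

/-- If the gradients of the vanishing constants are linearly independent, then `N` isolated orbits
appear arbitrarily close to the origin under arbitrarily small perturbations. -/
theorem exists_le_encard_isolatedOrbitsWithin (d N : ℕ) (a₀ : EuclideanSpace ℝ (Fin (d - 1)))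
    (hzero : ∀ j < N, VFun d (2 * j + 3) a₀ = 0) (hne : VFun d (2 * N + 3) a₀ ≠ 0)
    (hli : LinearIndependent ℝ fun j : Fin N => gradient (VFun d (2 * (j : ℕ) + 3)) a₀)
    {ε δ : ℝ} (hε : 0 < ε) (hδ : 0 < δ) :
    ∃ a ∈ Metric.ball a₀ ε, (N : ℕ∞) ≤ (isolatedOrbitsWithin (polyFamily d a) δ).encard := by
  have hne' : VFun d (2 * (N + 1) + 1) a₀ ≠ 0 := hne
  obtain ⟨u, huA, hu1, hdisp⟩ := exists_displacement_eq_sum d (Nat.le_add_left 1 N) a₀ hne'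
  obtain ⟨ρ, hρ, hbound⟩ :=
    exists_forall_encard_isolatedOrbitsWithin_le d (Nat.le_add_left 1 N) a₀ hne'
  obtain ⟨r, hr, hneg⟩ := exists_polyFamily_neg d a₀
  have hopen : 𝓝 0 ≤ map (fun a (j : Fin N) => VFun d (2 * (j.castSucc : ℕ) + 3) a) (𝓝 a₀) := by
    have h1 := map_nhds_eq_of_linearIndependent_gradient
      (g := fun j : Fin N => VFun d (2 * (j : ℕ) + 3)) (fun j => analyticAt_eval _ _ a₀) hli
    have h2 : (fun j : Fin N => VFun d (2 * (j : ℕ) + 3) a₀) = 0 := funext fun j => hzero j j.2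
    rw [h2] at h1
    exact h1.ge
  have hcont : ∀ a, Continuous fun x => polyFamily d a (polyFamily d a x) - x := by
    intro a
    unfold polyFamily
    fun_prop
  -- within radius `σ` all orbits are isolated; `f_a` maps `(0, η)` into that ball
  set σ := min δ ρ with hσ
  have hσ0 : 0 < σ := lt_min hδ hρ
  set η := min (σ / 2) r with hη
  have hη0 : 0 < η := lt_min (half_pos hσ0) hr
  obtain ⟨a, ha, hcard⟩ := exists_le_encard_zeros hcont
    (v := fun j a => VFun d (2 * (j : ℕ) + 3) a) (fun j => (huA j).continuousAt) hu1
    (analyticAt_eval _ (V d (2 * N + 3)) a₀).continuousAt hne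
    (((analyticAt_eval _ (V d (2 * N + 3)) a₀).continuousAt.eventually_ne hne).mono
      fun a ha => hdisp a ha) hopen
    (Metric.ball_mem_nhds a₀ (lt_min hε (lt_min hr hρ))) hη0
  refine ⟨a, Metric.ball_subset_ball (min_le_left _ _) ha, hcard.trans ?_⟩
  have har : a ∈ Metric.ball a₀ r :=
    Metric.ball_subset_ball ((min_le_right _ _).trans (min_le_left _ _)) ha
  have haρ : a ∈ Metric.ball a₀ ρ :=
    Metric.ball_subset_ball ((min_le_right _ _).trans (min_le_right _ _)) ha
  have hsub : Metric.ball (0 : ℝ) η ⊆ Metric.ball 0 r := Metric.ball_subset_ball (min_le_right _ _)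
  have hneg' : ∀ x ∈ Metric.ball (0 : ℝ) η, x ≠ 0 → polyFamily d a x * x < 0 :=
    fun x hx hx0 => (hneg a har x (hsub hx) hx0).1
  have hfin : {O | IsTwoPeriodicOrbit (polyFamily d a) O ∧ O ⊆ Metric.ball (0 : ℝ) σ}.Finite := by
    have h1 : {O | IsTwoPeriodicOrbit (polyFamily d a) O ∧ O ⊆ Metric.ball (0 : ℝ) ρ}.Finite := by
      rw [← encard_lt_top_iff]
      exact lt_of_le_of_lt le_self_add ((hbound a haρ).trans_lt (ENat.natCast_lt_top _))
    exact h1.subset fun O hO => ⟨hO.1, hO.2.trans (Metric.ball_subset_ball (min_le_right _ _))⟩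
  refine le_trans ?_ (encard_le_encard (isolatedOrbitsWithin_mono _ (min_le_left δ ρ)))
  rw [isolatedOrbitsWithin_eq_of_finite hfin,
    ← ((injOn_pair hneg').mono (sep_subset _ _)).encard_image]
  refine encard_le_encard (image_subset_twoPeriodicOrbits
    ((min_le_left _ _).trans (half_le_self hσ0.le)) hneg' fun x hx => ?_)
  have hxη : x ∈ Metric.ball (0 : ℝ) η := by
    rw [mem_ball_zero_iff, Real.norm_eq_abs, abs_of_pos hx.1]
    exact hx.2
  have h1 := (hneg a har x (hsub hxη) hx.1.ne').2
  rw [abs_of_pos hx.1] at h1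
  have h2 := hx.2.trans_le (min_le_left (σ / 2) r)
  rw [mem_ball_zero_iff, Real.norm_eq_abs]
  linarith
end TwoCyclicity

theorem mainTheorem3 (d : ℕ) (hd : 2 ≤ d) (m : ℕ) (hm : 1 ≤ m)
    (a₀ : EuclideanSpace ℝ (Fin (d - 1)))
    (hzero : ∀ j : ℕ, 1 ≤ j → j ≤ m - 1 → TwoCyclicity.VFun d (2 * j + 1) a₀ = 0)
    (hne : TwoCyclicity.VFun d (2 * m + 1) a₀ ≠ 0) :
    ((∃ N : ℕ, TwoCyclicity.HasTwoCyclicity Set.univ (TwoCyclicity.polyFamily d) a₀ N) ∧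
      ∀ N : ℕ, TwoCyclicity.HasTwoCyclicity Set.univ (TwoCyclicity.polyFamily d) a₀ N →
        N ≤ m - 1) ∧
    (LinearIndependent ℝ
        (fun j : Fin (m - 1) => gradient (TwoCyclicity.VFun d (2 * (j : ℕ) + 3)) a₀) →
      ∀ N : ℕ, TwoCyclicity.HasTwoCyclicity Set.univ (TwoCyclicity.polyFamily d) a₀ N ↔
        N = m - 1) := by
  obtain ⟨M, rfl⟩ : ∃ M, m = M + 1 := ⟨m - 1, by omega⟩
  rw [Nat.add_sub_cancel] at *
  obtain ⟨ρ, hρ, hbound⟩ :=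
    TwoCyclicity.exists_forall_encard_isolatedOrbitsWithin_le d hm a₀ hne
  have hle : ∃ ε > 0, ∃ δ > 0, ∀ a ∈ Metric.ball a₀ ε,
      (TwoCyclicity.isolatedOrbitsWithin (TwoCyclicity.polyFamily d a) δ).encard ≤ (M : ℕ∞) := by
    refine ⟨ρ, hρ, ρ, hρ, fun a ha => le_trans (Set.encard_le_encard ?_)
      ((ENat.add_le_add_iff_right ENat.one_ne_top).1 (by simpa using hbound a ha))⟩
    exact fun O hO => ⟨hO.1.1, hO.2⟩
  refine ⟨⟨TwoCyclicity.exists_hasTwoCyclicity_of_forall_le hle,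
    fun N hN => hN.le_of_forall_le hle⟩, fun hli N => ?_⟩
  have hM : TwoCyclicity.HasTwoCyclicity Set.univ (TwoCyclicity.polyFamily d) a₀ M :=
    TwoCyclicity.hasTwoCyclicity_of_le_of_forall_exists hle fun ε hε δ hδ =>
      TwoCyclicity.exists_le_encard_isolatedOrbitsWithin d M a₀
        (fun j hj => hzero (j + 1) (by omega) (by omega)) hne hli hε hδ
  exact ⟨fun hN => hN.unique hM, fun h => h ▸ hM⟩
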